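/- Let $A$ be a $4\times 4$ complex matrix that is a partial isometry, i.e. $\|Ax\|=\|x\|$ for all $x\in\mathbb C^4$ orthogonal to $\ker A$ (Euclidean norm). Let $W(A)=\{\langle Ax,x\rangle : x\in\mathbb C^4,\ \|x\|=1\}$ be its numerical range. (NF) If $A$ is unitarily irreducible (that is, not unitarily similar to a direct sum of two matrices of smaller size; equivalently, no subspace other than $\{0\}$ and $\mathbb C^4$ is invariant under $A$ together with its orthogonal complement), then $A$ is generic: for every $\theta\in(-\pi,\pi]$ the eigenvalues $\lambda_1(\theta)\ge\lambda_2(\theta)\ge\lambda_3(\theta)\ge\lambda_4(\theta)$, counted with multiplicity, of the hermitian matrix $\operatorname{Re}(e^{-i\theta}A)=\tfrac12\left(e^{-i\theta}A+e^{i\theta}A^*\right)$ satisfy $\lambda_1(\theta)>\lambda_2(\theta)>\lambda_3(\theta)>\lambda_4(\theta)$. Moreover, the boundary $\partial W(A)$ then contains no non-degenerate line segment. (Circ) If $A$ is nilpotent, then $W(A)$ is a closed circular disk centered at the origin, i.e. $W(A)=\{z\in\mathbb C : |z|\le r\}$ for some $r\ge 0$, where $r>0$ unless $A=0$. -/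

import Mathlib

namespace NumRange

/-- The linear operator `x ↦ A x` on `ℂⁿ` with its standard inner product. -/
noncomputable abbrev op {n : ℕ} (A : Matrix (Fin n) (Fin n) ℂ) :
    EuclideanSpace ℂ (Fin n) →ₗ[ℂ] EuclideanSpace ℂ (Fin n) :=
  Matrix.toEuclideanLin A

/-- The numerical range `W(A) = {⟨Ax, x⟩ : ‖x‖ = 1}`. Mathlib's inner product is linear in its
second argument, so the paper's `⟨Ax, x⟩` is `inner ℂ x (A x)`. -/
def numericalRange {n : ℕ} (A : Matrix (Fin n) (Fin n) ℂ) : Set ℂ :=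
  {z | ∃ x : EuclideanSpace ℂ (Fin n), ‖x‖ = 1 ∧ inner ℂ x (op A x) = z}

/-- `A` preserves the norms of the vectors orthogonal to its kernel. -/
def IsPartialIsometry {n : ℕ} (A : Matrix (Fin n) (Fin n) ℂ) : Prop :=
  ∀ x ∈ (LinearMap.ker (op A))ᗮ, ‖op A x‖ = ‖x‖

/-- `A` is unitarily irreducible (not unitarily similar to a direct sum of two smaller matrices):
the only subspaces `S` such that both `S` and its orthogonal complement are invariant under `A`
are `{0}` and `ℂⁿ`. -/
def IsUnitarilyIrreducible {n : ℕ} (A : Matrix (Fin n) (Fin n) ℂ) : Prop :=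
  ∀ S : Submodule ℂ (EuclideanSpace ℂ (Fin n)),
    (∀ x ∈ S, op A x ∈ S) → (∀ x ∈ Sᗮ, op A x ∈ Sᗮ) → S = ⊥ ∨ S = ⊤

/-- The hermitian part `Re X = (X + X*) / 2`. -/
noncomputable def rePart {n : ℕ} (X : Matrix (Fin n) (Fin n) ℂ) : Matrix (Fin n) (Fin n) ℂ :=
  (1 / 2 : ℂ) • (X + X.conjTranspose)

theorem rePart_isHermitian {n : ℕ} (X : Matrix (Fin n) (Fin n) ℂ) : (rePart X).IsHermitian := by
  simp [rePart, Matrix.IsHermitian, add_comm]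

/-- `A` is generic: for all `θ ∈ (-π, π]`, the eigenvalues
`λ₁(θ) ≥ λ₂(θ) ≥ … ≥ λₙ(θ)` of `Re (e^{-iθ} A)`, listed in decreasing order and repeated according
to multiplicity, satisfy strict inequalities `λ₁(θ) > λ₂(θ) > … > λₙ(θ)`. -/
def IsGeneric {n : ℕ} (A : Matrix (Fin n) (Fin n) ℂ) : Prop :=
  ∀ θ ∈ Set.Ioc (-Real.pi) Real.pi,
    StrictAnti (rePart_isHermitian (Complex.exp (-(Complex.I * θ)) • A)).eigenvalues₀

end NumRange

/-!
Write `T` for the operator of `A` and `T*` for its adjoint; a partial isometry satisfies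
`T T* T = T`, and `e^{-iθ} A` is again a partial isometry with the same reducing subspaces, so only
`θ = 0` matters for genericity.

Genericity. Let `E` be the space of solutions of `T x + T* x = 2 l x` and suppose that it has
dimension at least two. If `E` contains a nonzero `x` in the range of `T*`, then `T* T x = x`, so
`T*² x - 2 l T* x + x = 0`. As `|l| ≤ 1`, the roots of this quadratic are unimodular, hence `T*` has
a unimodular eigenvalue, and a contraction splits along the eigenvectors of such an eigenvalue
(`not_isIrreducible_of_adjoint_apply_apply_eq`). In dimension four this leaves the case that the
range of `T*` has dimension at most two, in which either the range of `T` (for `l = 0`) or a span of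
two vectors `v`, `T v` (for `l ≠ 0`) is reducing (`finrank_eigenspace_add_adjoint_lt_two`).

Segments. The numerical range is compact, and convex by the Toeplitz–Hausdorff theorem
(`convex_setOf_inner_apply`). A supporting line at the midpoint of a boundary segment contains both
endpoints, and unit vectors representing the endpoints are eigenvectors of `Re (e^{-iθ} A)` for its
largest eigenvalue. By genericity they are proportional, so the endpoints coincide.

Nilpotent matrices. The traces of the first four powers of `Re (c A)`, `|c| = 1`, do not depend on
`c`: all words in `A` and `A*` with different numbers of `A` and `A*` and length at most four have
trace zero, because `A A* A = A` and `A` is nilpotent (`trace_rePart_smul_pow`). By Newton's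
identities the eigenvalues of `Re (c A)` do not depend on `c` either, so the support function of the
compact convex set `W(A)` is constant, and `W(A)` is a disk about the origin.
-/

/-! ### Reducing subspaces of partial isometries -/

section Operator
open Module LinearMap

variable {V : Type*} [NormedAddCommGroup V] [InnerProductSpace ℂ V]

/-- The case of equality in the Cauchy-Schwarz inequality, for a vector no longer than `y`. -/
theorem eq_of_norm_le_of_re_inner {x y : V} (hx : ‖x‖ ≤ ‖y‖)
    (h : (inner ℂ x y).re = ‖y‖ ^ 2) : x = y := by
  have h1 := norm_sub_sq (𝕜 := ℂ) x y
  have h2 : RCLike.re (inner ℂ x y) = ‖y‖ ^ 2 := h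
  have h3 : ‖x - y‖ ^ 2 ≤ 0 := by
    rw [h1, h2]
    nlinarith [norm_nonneg x, norm_nonneg y]
  have h4 : ‖x - y‖ = 0 := by nlinarith [norm_nonneg (x - y)]
  exact sub_eq_zero.1 (norm_eq_zero.1 h4)

variable [FiniteDimensional ℂ V]

/-- A reducing subspace of `T` is one that is invariant under `T` and its adjoint; `T` is
irreducible if it has only the two trivial ones. -/
def LinearMap.IsIrreducible (T : V →ₗ[ℂ] V) : Prop :=
  ∀ S : Submodule ℂ V, (∀ x ∈ S, T x ∈ S) → (∀ x ∈ S, adjoint T x ∈ S) → S = ⊥ ∨ S = ⊤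

theorem norm_le_of_isometry_on_ker_orthogonal {T : V →ₗ[ℂ] V}
    (hT : ∀ x ∈ (ker T)ᗮ, ‖T x‖ = ‖x‖) (x : V) : ‖T x‖ ≤ ‖x‖ := by
  obtain ⟨p, hp, q, hq, rfl⟩ := (ker T).exists_add_mem_mem_orthogonal x
  have h0 : T p = 0 := hp
  rw [map_add, h0, zero_add, hT q hq]
  have h := norm_add_sq_eq_norm_sq_add_norm_sq_of_inner_eq_zero p q
    ((Submodule.mem_orthogonal _ _).1 hq p hp)
  nlinarith [norm_nonneg p, norm_nonneg q, norm_nonneg (p + q)]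

theorem norm_adjoint_le {T : V →ₗ[ℂ] V} (hT : ∀ x, ‖T x‖ ≤ ‖x‖) (x : V) :
    ‖adjoint T x‖ ≤ ‖x‖ := by
  have h1 : ‖adjoint T x‖ ^ 2 ≤ ‖adjoint T x‖ * ‖x‖ := by
    rw [← inner_self_eq_norm_sq (𝕜 := ℂ) (adjoint T x), adjoint_inner_right]
    calc _ ≤ ‖T (adjoint T x)‖ * ‖x‖ := re_inner_le_norm _ _
      _ ≤ _ := by gcongr; exact hT _
  by_contra! h
  nlinarith [norm_nonneg x, norm_nonneg (adjoint T x)]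

/-- An operator that is isometric on the orthogonal complement of its kernel satisfies
`T T* T = T`. -/
theorem apply_adjoint_apply_of_isometry_on_ker_orthogonal {T : V →ₗ[ℂ] V}
    (hT : ∀ x ∈ (ker T)ᗮ, ‖T x‖ = ‖x‖) (x : V) : T (adjoint T (T x)) = T x := by
  have hc := norm_le_of_isometry_on_ker_orthogonal hT
  obtain ⟨p, hp, q, hq, rfl⟩ := (ker T).exists_add_mem_mem_orthogonal x
  have h0 : T p = 0 := hp
  have h1 : adjoint T (T q) = q := by
    refine eq_of_norm_le_of_re_inner ((norm_adjoint_le hc _).trans (hc q)) ?_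
    rw [adjoint_inner_left, ← hT q hq]
    exact inner_self_eq_norm_sq (𝕜 := ℂ) (T q)
  rw [map_add, h0, zero_add, h1]

theorem adjoint_apply_adjoint {T : V →ₗ[ℂ] V} (hT : ∀ x, T (adjoint T (T x)) = T x) (x : V) :
    adjoint T (T (adjoint T x)) = adjoint T x := by
  refine ext_inner_left ℂ fun v ↦ ?_
  rw [adjoint_inner_right, ← adjoint_inner_left T, adjoint_inner_right, hT, adjoint_inner_right]

/-- A unimodular eigenvalue of the adjoint of a contraction splits off. -/
theorem apply_eq_of_adjoint_apply_eq {T : V →ₗ[ℂ] V} (hc : ∀ x, ‖T x‖ ≤ ‖x‖) {v : V} {μ : ℂ}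
    (hμ : ‖μ‖ = 1) (hv : adjoint T v = μ • v) : T v = star μ • v := by
  refine eq_of_norm_le_of_re_inner ((hc v).trans (by simp [norm_smul, hμ])) ?_
  have : inner ℂ (T v) (star μ • v) = ((‖v‖ ^ 2 : ℝ) : ℂ) := by
    rw [← adjoint_inner_right, map_smul, hv, smul_smul, inner_smul_right,
      inner_self_eq_norm_sq_to_K, Complex.star_def, Complex.conj_mul', hμ]
    simp
  rw [this, Complex.ofReal_re]
  simp [norm_smul, hμ]

theorem not_isIrreducible_of_mem_span {T : V →ₗ[ℂ] V} {v w : V} (hd : 2 < finrank ℂ V)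
    (hv : v ≠ 0) (h1 : T v ∈ Submodule.span ℂ {v, w}) (h2 : T w ∈ Submodule.span ℂ {v, w})
    (h3 : adjoint T v ∈ Submodule.span ℂ {v, w}) (h4 : adjoint T w ∈ Submodule.span ℂ {v, w}) :
    ¬ T.IsIrreducible := by
  intro h
  have key : ∀ R : V →ₗ[ℂ] V, R v ∈ Submodule.span ℂ {v, w} → R w ∈ Submodule.span ℂ {v, w} →
      ∀ x ∈ Submodule.span ℂ {v, w}, R x ∈ Submodule.span ℂ {v, w} := by
    intro R hv hw x hx
    obtain ⟨a, b, rfl⟩ := Submodule.mem_span_pair.1 hx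
    rw [map_add, map_smul, map_smul]
    exact add_mem (Submodule.smul_mem _ _ hv) (Submodule.smul_mem _ _ hw)
  rcases h _ (key T h1 h2) (key _ h3 h4) with h | h
  · have : v ∈ Submodule.span ℂ {v, w} := Submodule.subset_span (by simp)
    rw [h] at this
    exact hv (by simpa using this)
  · classical
    have := finrank_span_finset_le_card (R := ℂ) ({v, w} : Finset V)
    rw [Set.finrank, Finset.coe_pair, h, finrank_top] at this
    have := Finset.card_le_two (a := v) (b := w)
    omega

/-- If `T* T x = x` and `x` is an eigenvector of `T + T*`, then `T*` satisfies on `x` a quadratic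
equation with unimodular roots, and so has a unimodular eigenvalue. -/
theorem not_isIrreducible_of_adjoint_apply_apply_eq {T : V →ₗ[ℂ] V} (hd : 2 < finrank ℂ V)
    (hc : ∀ x, ‖T x‖ ≤ ‖x‖) {x : V} {l : ℝ} (hx : x ≠ 0) (h1 : adjoint T (T x) = x)
    (h2 : T x + adjoint T x = (2 * l : ℂ) • x) : ¬ T.IsIrreducible := by
  suffices h : ∃ v : V, ∃ μ : ℂ, v ≠ 0 ∧ ‖μ‖ = 1 ∧ adjoint T v = μ • v by
    obtain ⟨v, μ, hv, hμ, h⟩ := h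
    have h' := apply_eq_of_adjoint_apply_eq hc hμ h
    have hs (c : ℂ) : c • v ∈ Submodule.span ℂ {v, v} :=
      Submodule.smul_mem _ _ (Submodule.subset_span (by simp))
    exact not_isIrreducible_of_mem_span hd hv (h' ▸ hs _) (h' ▸ hs _) (h ▸ hs _) (h ▸ hs _)
  have hl : l ^ 2 ≤ 1 := by
    have h3 := norm_add_le (T x) (adjoint T x)
    rw [h2, norm_smul] at h3
    have h4 := hc x
    have h5 := norm_adjoint_le hc x
    have h6 : ‖(2 * l : ℂ)‖ = 2 * |l| := by simp
    rw [h6] at h3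
    have h7 : |l| ≤ 1 := by
      by_contra! h
      nlinarith [norm_pos_iff.2 hx]
    rw [← sq_abs]
    nlinarith [abs_nonneg l]
  have hq : (√(1 - l ^ 2)) ^ 2 = 1 - l ^ 2 := Real.sq_sqrt (by linarith)
  have hqc : ((√(1 - l ^ 2) : ℝ) : ℂ) ^ 2 = 1 - (l : ℂ) ^ 2 := by exact_mod_cast hq
  generalize √(1 - l ^ 2) = q at hq hqc
  -- The roots of `X ^ 2 - 2 l X + 1` are `l ± q i`, and they are unimodular.
  have hn : ∀ s : ℝ, s ^ 2 = q ^ 2 → ‖(l + s * Complex.I : ℂ)‖ = 1 := by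
    intro s hs
    rw [Complex.norm_add_mul_I, hs, hq]
    simp
  have h3 : adjoint T (adjoint T x) = (2 * l : ℂ) • adjoint T x - x := by
    have := congrArg (adjoint T) h2
    rw [map_add, h1, map_smul] at this
    rw [← this]; abel
  -- Either `x` is an eigenvector for one root, or `T* x` minus that root times `x` is one for the
  -- other root.
  by_cases hw : adjoint T x = (l + q * Complex.I : ℂ) • x
  · exact ⟨x, _, hx, hn q rfl, hw⟩
  · refine ⟨adjoint T x - (l + q * Complex.I : ℂ) • x, (l + (-q : ℝ) * Complex.I : ℂ),
      sub_ne_zero.2 hw, hn (-q) (by ring), ?_⟩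
    rw [map_sub, map_smul, h3]
    have h4 : ((l + (-q : ℝ) * Complex.I : ℂ)) * (l + q * Complex.I : ℂ) = 1 := by
      push_cast
      linear_combination (-(q : ℂ) ^ 2) * Complex.I_sq + hqc
    rw [smul_sub, smul_smul, h4]
    push_cast
    module

/-- An irreducible partial isometry `T` of a four-dimensional space has only simple eigenvalues in
its real part. If the range of `T*` has dimension at least three, it meets every
two-dimensional subspace nontrivially. Otherwise a multiple eigenvalue `2 l` of `T + T*` forces either
(`l = 0`) the range of `T` to be reducing, or (`l ≠ 0`) the operator `T* - 2 l` to be inverse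
to `T* T T - 2 l` on the range of `T*`; in this second case an eigenvector `v` of `T* T T` there is
also one of `T*`, and `v` and `T v` span a reducing subspace. -/
theorem finrank_eigenspace_add_adjoint_lt_two {T : V →ₗ[ℂ] V} (hd : finrank ℂ V = 4)
    (hc : ∀ x, ‖T x‖ ≤ ‖x‖) (hT : ∀ x, T (adjoint T (T x)) = T x) (hirr : T.IsIrreducible)
    (l : ℝ) {E : Submodule ℂ V} (hE : ∀ x ∈ E, T x + adjoint T x = (2 * l : ℂ) • x) :
    finrank ℂ E < 2 := by
  by_contra! hE2
  have hT' := adjoint_apply_adjoint hT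
  set M := range (adjoint T) with hM
  have hPM : ∀ x ∈ M, adjoint T (T x) = x := by
    rintro _ ⟨y, rfl⟩
    exact hT' y
  have hEM : E ⊓ M = ⊥ := by
    rw [Submodule.eq_bot_iff]
    rintro x ⟨hxE, hxM⟩
    by_contra hx
    exact not_isIrreducible_of_adjoint_apply_apply_eq (by omega) hc hx (hPM x hxM) (hE x hxE) hirr
  have hM2 : finrank ℂ M ≤ 2 := by
    have h1 := Submodule.finrank_sup_add_finrank_inf_eq E M
    rw [hEM, finrank_bot] at h1
    have h2 := Submodule.finrank_le (E ⊔ M)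
    omega
  -- A linear map into `M` that is injective on `E` maps `E` onto `M`, by comparing dimensions.
  have hmap : ∀ R : V →ₗ[ℂ] V, (∀ x ∈ E, R x ∈ M) → (∀ x ∈ E, R x = 0 → x = 0) →
      M ≠ ⊥ ∧ ∀ y ∈ M, ∃ x ∈ E, R x = y := by
    intro R h1 h2
    let g : E →ₗ[ℂ] M := (R.domRestrict E).codRestrict M fun x ↦ h1 x x.2
    have hg : Function.Injective g := by
      rw [injective_iff_map_eq_zero]
      intro x hx
      exact Subtype.ext (h2 x x.2 (congrArg Subtype.val hx))
    have hle := finrank_le_finrank_of_injective hg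
    refine ⟨fun h ↦ ?_, fun y hy ↦ ?_⟩
    · rw [h, finrank_bot] at hle
      omega
    · obtain ⟨x, hx⟩ :=
        (injective_iff_surjective_of_finrank_eq_finrank (by omega)).1 hg ⟨y, hy⟩
      exact ⟨x, x.2, congrArg Subtype.val hx⟩
  rcases eq_or_ne l 0 with rfl | hl
  · have hneg : ∀ x ∈ E, adjoint T x = -T x := by
      intro x hx
      have := hE x hx
      simp only [Complex.ofReal_zero, mul_zero, zero_smul] at this
      exact (neg_eq_of_add_eq_zero_right this).symm
    have hinj : ∀ x ∈ E, adjoint T x = 0 → x = 0 := by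
      intro x hx h0
      by_contra hx0
      have h1 : T x = 0 := by simpa [h0] using (hneg x hx).symm
      exact not_isIrreducible_of_mem_span (w := x) (by omega) hx0 (by simp [h1]) (by simp [h1])
        (by simp [h0]) (by simp [h0]) hirr
    have hle : M ≤ range T := by
      intro y hy
      obtain ⟨x, hx, rfl⟩ := (hmap (adjoint T) (fun x _ ↦ ⟨x, rfl⟩) hinj).2 y hy
      rw [hneg x hx]
      exact ⟨-x, by simp⟩
    rcases hirr (range T) (fun x _ ↦ ⟨x, rfl⟩) (fun x _ ↦ hle ⟨x, rfl⟩) with h | h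
    · exact (hmap (adjoint T) (fun x _ ↦ ⟨x, rfl⟩) hinj).1 (by simpa [h] using hle)
    · have h1 := LinearMap.finrank_range_adjoint T
      rw [h, finrank_top, ← hM] at h1
      omega
  · have hl2 : (2 * l : ℂ) ≠ 0 := by simpa using hl
    have hinj : ∀ x ∈ E, (adjoint T ∘ₗ T) x = 0 → x = 0 := by
      intro x hx h0
      rw [comp_apply] at h0
      have h1 : T x = 0 := by rw [← hT x, h0, map_zero]
      have h2 := hE x hx
      rw [h1, zero_add] at h2
      have h3 : inner ℂ x (adjoint T x) = 0 := by rw [adjoint_inner_right, h1, inner_zero_left]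
      rw [h2, inner_smul_right] at h3
      simpa [hl] using h3
    have hin : ∀ x ∈ E, (adjoint T ∘ₗ T) x ∈ M := fun x _ ↦ ⟨T x, rfl⟩
    obtain ⟨hM0, hsurj⟩ := hmap _ hin hinj
    have hcomp : ∀ p ∈ M, adjoint T (adjoint T (T (T p)) - (2 * l : ℂ) • p) -
        (2 * l : ℂ) • (adjoint T (T (T p)) - (2 * l : ℂ) • p) = p := by
      intro p hp
      obtain ⟨x, hx, rfl⟩ := hsurj p hp
      have h1 := hE x hx
      have h2 : adjoint T (T (T x)) - (2 * l : ℂ) • adjoint T (T x) = -adjoint T x := by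
        have := congrArg (fun z ↦ adjoint T (T z)) h1
        simp only [map_add, map_smul, hT'] at this
        rw [← this]; abel
      have h3 : adjoint T (adjoint T x) = (2 * l : ℂ) • adjoint T x - adjoint T (T x) := by
        rw [← map_smul, ← h1, map_add]; abel
      rw [comp_apply, hT, h2, map_neg, h3]
      module
    have : Nontrivial M := Submodule.nontrivial_iff_ne_bot.2 hM0
    obtain ⟨c, hc'⟩ := End.exists_eigenvalue
      ((adjoint T ∘ₗ T ∘ₗ T).restrict (p := M) (q := M) fun x _ ↦ ⟨T (T x), rfl⟩)
    obtain ⟨⟨v, hvM⟩, hv⟩ := hc'.exists_hasEigenvector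
    have hv0 : v ≠ 0 := fun h ↦ hv.2 (Subtype.ext h)
    have hv1 : adjoint T (T (T v)) = c • v := congrArg Subtype.val hv.apply_eq_smul
    have h1 := hcomp v hvM
    rw [hv1, ← sub_smul, map_smul, smul_comm, ← smul_sub] at h1
    have hc0 : c - 2 * l ≠ 0 := by
      intro h
      rw [h, zero_smul] at h1
      exact hv0 h1.symm
    have h2 : adjoint T v = (2 * l + (c - 2 * l)⁻¹) • v := by
      have := congrArg ((c - 2 * l)⁻¹ • ·) h1
      simp only [smul_smul, inv_mul_cancel₀ hc0, one_smul] at this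
      rw [add_smul, ← this]; abel
    have h3 : T (T v) = c • T v := by rw [← hT (T v), hv1, map_smul]
    have hsv : v ∈ Submodule.span ℂ {v, T v} := Submodule.subset_span (by simp)
    have hsT : T v ∈ Submodule.span ℂ {v, T v} := Submodule.subset_span (by simp)
    exact not_isIrreducible_of_mem_span (by omega) hv0 hsT (h3 ▸ Submodule.smul_mem _ _ hsT)
      (h2 ▸ Submodule.smul_mem _ _ hsv) ((hPM v hvM).symm ▸ hsv) hirr

end Operator

/-! ### Convexity of the numerical range and supporting lines -/

section Convexity
open Module LinearMap

variable {V : Type*} [NormedAddCommGroup V] [InnerProductSpace ℂ V]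

/-- The normalized case of the Toeplitz–Hausdorff theorem, by the intermediate value theorem along
a segment from a unimodular multiple of `x` to `y`. -/
theorem exists_inner_apply_eq_of_zero_one {S : V →ₗ[ℂ] V} {x y : V} (hx : ‖x‖ = 1) (hy : ‖y‖ = 1)
    (hSx : inner ℂ x (S x) = 0) (hSy : inner ℂ y (S y) = 1) {t : ℝ} (ht : t ∈ Set.Icc 0 1) :
    ∃ z : V, ‖z‖ = 1 ∧ inner ℂ z (S z) = t := by
  -- The phase `u` makes the mixed terms in `⟪z, S z⟫` add up to a real number.
  obtain ⟨u, hu, huk⟩ := RCLike.exists_norm_eq_mul_self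
    (inner ℂ y (S x) - (starRingEnd ℂ) (inner ℂ x (S y)))
  obtain ⟨k, hk⟩ : ∃ k : ℝ, inner ℂ (u • x) (S y) + inner ℂ y (S (u • x)) = k := by
    refine ⟨_, (Complex.conj_eq_iff_re.1 ?_).symm⟩
    rw [map_smul, inner_smul_left, inner_smul_right]
    have h := congrArg (starRingEnd ℂ) huk
    simp only [RCLike.ofReal_eq_complex_ofReal, Complex.conj_ofReal] at h huk
    rw [huk] at h
    simp only [map_mul, map_sub, map_add, Complex.conj_conj] at h ⊢
    linear_combination -h
  have hx' : ‖u • x‖ = 1 := by rw [norm_smul, hu, hx, one_mul]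
  have hSx' : inner ℂ (u • x) (S (u • x)) = 0 := by
    rw [map_smul, inner_smul_left, inner_smul_right, hSx, mul_zero, mul_zero]
  generalize u • x = x' at hk hx' hSx'
  have hcont : Continuous fun s : ℝ ↦ s ^ 2 + s * (1 - s) * k -
      t * ‖((1 - s : ℝ) : ℂ) • x' + (s : ℂ) • y‖ ^ 2 := by fun_prop
  -- At a zero of this function the quadratic form of `S` is `t` times the squared norm.
  obtain ⟨s, -, hs⟩ : (0 : ℝ) ∈ (fun s : ℝ ↦ s ^ 2 + s * (1 - s) * k -
      t * ‖((1 - s : ℝ) : ℂ) • x' + (s : ℂ) • y‖ ^ 2) '' Set.Icc 0 1 := by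
    refine intermediate_value_Icc zero_le_one hcont.continuousOn ⟨?_, ?_⟩
    · simpa [hx'] using ht.1
    · simpa [hy] using ht.2
  simp only at hs
  have hz : inner ℂ (((1 - s : ℝ) : ℂ) • x' + (s : ℂ) • y)
      (S (((1 - s : ℝ) : ℂ) • x' + (s : ℂ) • y)) = (s ^ 2 + s * (1 - s) * k : ℝ) := by
    simp only [map_add, map_smul, inner_add_left, inner_add_right, inner_smul_left,
      inner_smul_right, hSx', hSy, Complex.conj_ofReal]
    push_cast
    linear_combination (s * (1 - s) : ℂ) * hk
  -- The segment avoids the origin, as proportional vectors would give proportional values.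
  have hz0 : ((1 - s : ℝ) : ℂ) • x' + (s : ℂ) • y ≠ 0 := by
    intro h
    have h1 : (s : ℂ) • y = (-((1 - s : ℝ) : ℂ)) • x' := by
      rw [neg_smul]; exact eq_neg_of_add_eq_zero_right h
    have h2 : inner ℂ ((s : ℂ) • y) (S ((s : ℂ) • y)) = 0 := by
      rw [h1, map_smul, inner_smul_left, inner_smul_right, hSx', mul_zero, mul_zero]
    rw [map_smul, inner_smul_left, inner_smul_right, hSy] at h2
    have h3 : s = 0 := by simpa using h2
    rw [h3] at h
    have h4 : x' = 0 := by simpa using h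
    simp [h4] at hx'
  generalize ((1 - s : ℝ) : ℂ) • x' + (s : ℂ) • y = z at hz hz0 hs
  refine ⟨((‖z‖⁻¹ : ℝ) : ℂ) • z, by simp [norm_smul, hz0], ?_⟩
  rw [map_smul, inner_smul_left, inner_smul_right, hz, sub_eq_zero.1 hs, Complex.conj_ofReal]
  have : (‖z‖ : ℂ) ≠ 0 := by simpa using hz0
  push_cast
  field_simp

/-- The **Toeplitz–Hausdorff theorem**: the numerical range is convex. -/
theorem convex_setOf_inner_apply (T : V →ₗ[ℂ] V) :
    Convex ℝ {z : ℂ | ∃ x : V, ‖x‖ = 1 ∧ inner ℂ x (T x) = z} := by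
  rw [convex_iff_segment_subset]
  rintro a ⟨x, hx, hxa⟩ b ⟨y, hy, hyb⟩ c hc
  rcases eq_or_ne a b with rfl | hab
  · rw [segment_same] at hc
    exact ⟨x, hx, hxa.trans hc.symm⟩
  rw [segment_eq_image_lineMap] at hc
  obtain ⟨t, ht, rfl⟩ := hc
  have hba : b - a ≠ 0 := sub_ne_zero.2 hab.symm
  -- An affine change of `T` moves `a` to `0` and `b` to `1`.
  have hS : ∀ v : V, ‖v‖ = 1 → inner ℂ v (((b - a)⁻¹ • (T - a • (LinearMap.id : V →ₗ[ℂ] V))) v) =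
      (b - a)⁻¹ * (inner ℂ v (T v) - a) := by
    intro v hv
    simp [inner_self_eq_norm_sq_to_K, hv]
  obtain ⟨z, hz, h⟩ := exists_inner_apply_eq_of_zero_one hx hy
    (by rw [hS x hx, hxa, sub_self, mul_zero]) (by rw [hS y hy, hyb, inv_mul_cancel₀ hba]) ht
  refine ⟨z, hz, ?_⟩
  rw [hS z hz] at h
  rw [AffineMap.lineMap_apply]
  simp only [vsub_eq_sub, vadd_eq_add, Complex.real_smul, ← h]
  field_simp
  ring

variable [FiniteDimensional ℂ V]

theorem isCompact_setOf_inner_apply (T : V →ₗ[ℂ] V) :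
    IsCompact {z : ℂ | ∃ x : V, ‖x‖ = 1 ∧ inner ℂ x (T x) = z} := by
  have := FiniteDimensional.proper ℂ V
  have hT : Continuous T := T.continuous_of_finiteDimensional
  convert (isCompact_sphere (0 : V) 1).image (f := fun x ↦ inner ℂ x (T x)) (by fun_prop) using 1
  ext z
  simp

/-- A unit vector at which the real part of the quadratic form of `T` is maximal is an eigenvector
of `T + T*`. -/
theorem apply_add_adjoint_apply_of_re_inner_le {T : V →ₗ[ℂ] V} {x : V} (hx : ‖x‖ = 1)
    (h : ∀ y : V, ‖y‖ = 1 → (inner ℂ y (T y)).re ≤ (inner ℂ x (T x)).re) :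
    T x + adjoint T x = (2 * (inner ℂ x (T x)).re : ℂ) • x := by
  have hsymm : (T + adjoint T).IsSymmetric := by
    intro u v
    simp [inner_add_left, inner_add_right, adjoint_inner_left, adjoint_inner_right, add_comm]
  have hinner : ∀ y : V, inner ℂ y ((T + adjoint T) y) = (2 * (inner ℂ y (T y)).re : ℂ) := by
    intro y
    rw [LinearMap.add_apply, inner_add_right, adjoint_inner_right, ← inner_conj_symm (T y) y,
      Complex.add_conj]
    push_cast
    rfl
  have := FiniteDimensional.complete ℂ V
  have hsa : IsSelfAdjoint (LinearMap.toContinuousLinearMap (T + adjoint T)) :=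
    ContinuousLinearMap.isSelfAdjoint_iff_isSymmetric.2 hsymm
  have hx0 : x ≠ 0 := by rintro rfl; simp at hx
  have hre : ∀ y : V, (LinearMap.toContinuousLinearMap (T + adjoint T)).reApplyInnerSelf y =
      2 * (inner ℂ y (T y)).re := by
    intro y
    rw [ContinuousLinearMap.reApplyInnerSelf_apply, inner_re_symm, coe_toContinuousLinearMap',
      hinner]
    simp
  have h1 := (hsa.hasEigenvector_of_isMaxOn hx0 (by
    intro y hy
    rw [hx, mem_sphere_zero_iff_norm] at hy
    simp only [Set.mem_ofPred_eq, hre]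
    linarith [h y hy])).apply_eq_smul
  obtain ⟨μ, h2⟩ : ∃ μ : ℂ, (T + adjoint T) x = μ • x := ⟨_, h1⟩
  have h3 := hinner x
  rw [h2, inner_smul_right, inner_self_eq_norm_sq_to_K, hx] at h3
  rw [← LinearMap.add_apply, h2, ← h3]
  simp

/-- A convex set in the plane has a supporting line at each boundary point belonging to it; the
line is described by its normal direction `e^{iθ}`. -/
theorem exists_re_mul_le_of_mem_frontier {W : Set ℂ} (hW : Convex ℝ W) {m : ℂ}
    (hm : m ∈ W) (hmf : m ∈ frontier W) :
    ∃ θ ∈ Set.Ioc (-Real.pi) Real.pi, ∀ z ∈ W,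
      (Complex.exp (-(Complex.I * θ)) * z).re ≤ (Complex.exp (-(Complex.I * θ)) * m).re := by
  obtain ⟨f, hf, h⟩ : ∃ f : ℂ →ₗ[ℝ] ℝ, f ≠ 0 ∧ ∀ z ∈ W, f z ≤ f m := by
    rcases (interior W).eq_empty_or_nonempty with hi | hi
    · -- A convex set without interior lies in a line, on which a nonzero functional is constant.
      have hlt : vectorSpan ℝ W < ⊤ := by
        rw [lt_top_iff_ne_top, Ne, ← AffineSubspace.affineSpan_eq_top_iff_vectorSpan_eq_top_of_nonempty
          ℝ ℂ ℂ ⟨m, hm⟩, ← hW.interior_nonempty_iff_affineSpan_eq_top, hi]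
        simp
      obtain ⟨f, hf, hle⟩ := Submodule.exists_le_ker_of_lt_top _ hlt
      refine ⟨f, hf, fun z hz ↦ (sub_eq_zero.1 ?_).le⟩
      rw [← map_sub]
      exact hle (vsub_mem_vectorSpan ℝ hz hm)
    · obtain ⟨f, hf, h⟩ := geometric_hahn_banach_of_nonempty_interior_point hW hmf.2 hi
      exact ⟨f, fun h0 ↦ hf (ContinuousLinearMap.coe_injective h0), h⟩
  set c : ℂ := ⟨f 1, -f Complex.I⟩ with hc
  have hfc : ∀ z, f z = (c * z).re := by
    intro z
    have hz : z = z.re • (1 : ℂ) + z.im • Complex.I := by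
      rw [Complex.real_smul, Complex.real_smul, mul_one, Complex.re_add_im]
    conv_lhs => rw [hz, map_add, map_smul, map_smul]
    simp only [smul_eq_mul, Complex.mul_re, hc]
    ring
  have hc0 : 0 < ‖c‖ := by
    rw [norm_pos_iff]
    intro h0
    exact hf (LinearMap.ext fun z ↦ by simp [hfc, h0])
  have hpolar : c = (‖c‖ : ℂ) * Complex.exp (-(Complex.I * (star c).arg)) := by
    have := congrArg (starRingEnd ℂ) (Complex.norm_mul_exp_arg_mul_I (star c))
    rw [map_mul, Complex.conj_ofReal, norm_star, ← Complex.exp_conj] at this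
    rw [mul_comm Complex.I]
    simpa using this.symm
  refine ⟨(star c).arg, Complex.arg_mem_Ioc _, fun z hz ↦ ?_⟩
  have h1 := h z hz
  rw [hfc, hfc, hpolar, mul_assoc, mul_assoc, Complex.re_ofReal_mul, Complex.re_ofReal_mul] at h1
  exact le_of_mul_le_mul_left h1 hc0

end Convexity

/-! ### Genericity and boundary segments -/

section Matrices
open Module LinearMap NumRange

theorem LinearMap.IsIrreducible.smul {V : Type*} [NormedAddCommGroup V] [InnerProductSpace ℂ V]
    [FiniteDimensional ℂ V] {T : V →ₗ[ℂ] V} (hT : T.IsIrreducible) {c : ℂ} (hc : c ≠ 0) :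
    (c • T).IsIrreducible := by
  intro S h1 h2
  refine hT S (fun x hx ↦ ?_) fun x hx ↦ ?_
  · exact (S.smul_mem_iff hc).1 (h1 x hx)
  · have := h2 x hx
    rw [map_smulₛₗ] at this
    exact (S.smul_mem_iff ((map_ne_zero (starRingEnd ℂ)).2 hc)).1 this

theorem NumRange.IsUnitarilyIrreducible.isIrreducible {n : ℕ} {A : Matrix (Fin n) (Fin n) ℂ}
    (hA : IsUnitarilyIrreducible A) : (op A).IsIrreducible := by
  intro S h1 h2
  refine hA S h1 fun x hx ↦ (Submodule.mem_orthogonal _ _).2 fun u hu ↦ ?_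
  rw [← adjoint_inner_left]
  exact (Submodule.mem_orthogonal _ _).1 hx _ (h2 u hu)

theorem op_smul {n : ℕ} (c : ℂ) (A : Matrix (Fin n) (Fin n) ℂ) : op (c • A) = c • op A :=
  map_smul _ _ _

theorem NumRange.IsPartialIsometry.smul {n : ℕ} {A : Matrix (Fin n) (Fin n) ℂ}
    (hA : IsPartialIsometry A) {c : ℂ} (hc : ‖c‖ = 1) : IsPartialIsometry (c • A) := by
  have hc0 : c ≠ 0 := by rintro rfl; simp at hc
  intro x hx
  rw [op_smul, LinearMap.ker_smul _ _ hc0] at hx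
  rw [op_smul, LinearMap.smul_apply, norm_smul, hc, one_mul, hA x hx]

theorem op_rePart {n : ℕ} (A : Matrix (Fin n) (Fin n) ℂ) (x : EuclideanSpace ℂ (Fin n)) :
    (2 : ℂ) • op (rePart A) x = op A x + adjoint (op A) x := by
  rw [rePart, op_smul, LinearMap.smul_apply, smul_smul, ← Matrix.toEuclideanLin_conjTranspose_eq_adjoint]
  simp [op]

theorem norm_exp_neg_I_mul (θ : ℝ) : ‖Complex.exp (-(Complex.I * θ))‖ = 1 := by
  rw [Complex.norm_exp]
  simp

/-- For an irreducible partial isometry in dimension four, eigenvectors of `Re A` for the same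
eigenvalue are proportional. -/
theorem not_linearIndependent_of_add_adjoint {A : Matrix (Fin 4) (Fin 4) ℂ}
    (hA : IsPartialIsometry A) (hirr : (op A).IsIrreducible) (l : ℝ)
    {v : Fin 2 → EuclideanSpace ℂ (Fin 4)}
    (hv : ∀ i, op A (v i) + adjoint (op A) (v i) = (2 * l : ℂ) • v i) :
    ¬ LinearIndependent ℂ v := by
  intro hli
  have h1 := finrank_eigenspace_add_adjoint_lt_two (by simp)
    (norm_le_of_isometry_on_ker_orthogonal hA)
    (apply_adjoint_apply_of_isometry_on_ker_orthogonal hA) hirr l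
    (E := Submodule.span ℂ (Set.range v)) (by
      intro x hx
      induction hx using Submodule.span_induction with
      | mem x hx => obtain ⟨i, rfl⟩ := hx; exact hv i
      | zero => simp
      | add x y _ _ hx hy => rw [map_add, map_add, smul_add, ← hx, ← hy]; abel
      | smul a x _ hx => rw [map_smul, map_smul, ← smul_add, hx, smul_comm])
  rw [finrank_span_eq_card hli, Fintype.card_fin] at h1
  exact lt_irrefl _ h1

theorem strictAnti_eigenvalues₀_rePart {B : Matrix (Fin 4) (Fin 4) ℂ}
    (hB : IsPartialIsometry B) (hirr : (op B).IsIrreducible) :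
    StrictAnti (rePart_isHermitian B).eigenvalues₀ := by
  have hsym := Matrix.isSymmetric_toEuclideanLin_iff.2 (rePart_isHermitian B)
  refine (Matrix.IsHermitian.eigenvalues₀_antitone _).strictAnti_of_injective fun i j hij ↦ ?_
  by_contra hne
  let b := hsym.eigenvectorBasis finrank_euclideanSpace
  have hb : ∀ i, op B (b i) + adjoint (op B) (b i) =
      (2 * ((rePart_isHermitian B).eigenvalues₀ i : ℝ) : ℂ) • b i := by
    intro i
    rw [← op_rePart, mul_smul]
    exact congrArg _ (hsym.apply_eigenvectorBasis finrank_euclideanSpace i)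
  refine not_linearIndependent_of_add_adjoint hB hirr ((rePart_isHermitian B).eigenvalues₀ i)
    (v := b ∘ ![i, j]) ?_ (b.orthonormal.linearIndependent.comp _ ?_)
  · intro k
    fin_cases k
    · exact hb i
    · rw [hij]; exact hb j
  · intro k k' h
    fin_cases k <;> fin_cases k' <;> simp_all

theorem isGeneric_of_isPartialIsometry {A : Matrix (Fin 4) (Fin 4) ℂ}
    (hA : IsPartialIsometry A) (hirr : (op A).IsIrreducible) : IsGeneric A := fun θ _ ↦
  strictAnti_eigenvalues₀_rePart (hA.smul (norm_exp_neg_I_mul θ))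
    (op_smul _ A ▸ hirr.smul (Complex.exp_ne_zero _))

/-- Both endpoints of a boundary segment lie on the supporting line at its midpoint, so that unit
vectors representing them belong to the same, one-dimensional, eigenspace. -/
theorem eq_of_segment_subset_frontier {A : Matrix (Fin 4) (Fin 4) ℂ}
    (hA : IsPartialIsometry A) (hirr : (op A).IsIrreducible) {a b : ℂ}
    (hab : segment ℝ a b ⊆ frontier (numericalRange A)) : a = b := by
  have hconv : Convex ℝ (numericalRange A) := convex_setOf_inner_apply (op A)
  have hclosed : IsClosed (numericalRange A) := (isCompact_setOf_inner_apply (op A)).isClosed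
  have hsub := hab.trans hclosed.frontier_subset
  have hm := midpoint_mem_segment (𝕜 := ℝ) a b
  obtain ⟨θ, -, hθ⟩ := exists_re_mul_le_of_mem_frontier hconv (hsub hm) (hab hm)
  set c := Complex.exp (-(Complex.I * θ)) with hc
  have ha := hθ a (hsub (left_mem_segment ℝ a b))
  have hb := hθ b (hsub (right_mem_segment ℝ a b))
  have hmid : (c * midpoint ℝ a b).re = ((c * a).re + (c * b).re) / 2 := by
    rw [midpoint_eq_smul_add, Complex.real_smul, mul_left_comm, Complex.re_ofReal_mul, mul_add,
      Complex.add_re]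
    norm_num
    ring
  obtain ⟨x, hx, hxa⟩ := hsub (left_mem_segment ℝ a b)
  obtain ⟨y, hy, hyb⟩ := hsub (right_mem_segment ℝ a b)
  have hq : ∀ z, inner ℂ z (op (c • A) z) = c * inner ℂ z (op A z) := by
    intro z
    rw [op_smul, LinearMap.smul_apply, inner_smul_right]
  have hle : ∀ z, ‖z‖ = 1 → (inner ℂ z (op (c • A) z)).re ≤ (c * midpoint ℝ a b).re := by
    intro z hz
    rw [hq]
    exact hθ _ ⟨z, hz, rfl⟩
  have hxr : (inner ℂ x (op (c • A) x)).re = (c * midpoint ℝ a b).re := by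
    rw [hq, hxa]; linarith
  have hyr : (inner ℂ y (op (c • A) y)).re = (c * midpoint ℝ a b).re := by
    rw [hq, hyb]; linarith
  have hxe := apply_add_adjoint_apply_of_re_inner_le hx (fun z hz ↦ (hle z hz).trans_eq hxr.symm)
  have hye := apply_add_adjoint_apply_of_re_inner_le hy (fun z hz ↦ (hle z hz).trans_eq hyr.symm)
  rw [hxr] at hxe
  rw [hyr] at hye
  have hBirr := hirr.smul (Complex.exp_ne_zero (-(Complex.I * θ)))
  rw [← hc, ← op_smul] at hBirr
  have hdep := not_linearIndependent_of_add_adjoint (hA.smul (norm_exp_neg_I_mul θ)) hBirr _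
    (v := ![x, y]) (by
      intro i
      fin_cases i
      · exact hxe
      · exact hye)
  have hx0 : x ≠ 0 := by rintro rfl; simp at hx
  rw [LinearIndependent.pair_iff' hx0] at hdep
  push Not at hdep
  obtain ⟨k, rfl⟩ := hdep
  have hk : ‖k‖ = 1 := by simpa [norm_smul, hx] using hy
  rw [← hxa, ← hyb, map_smul, inner_smul_left, inner_smul_right, ← mul_assoc, Complex.conj_mul', hk]
  simp

end Matrices

/-! ### Nilpotent partial isometries -/

section Nilpotent
open Module LinearMap NumRange Matrix

/-- Four real numbers are determined, up to order, by their first four power sums; the conclusion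
records only that each number on one side occurs on the other. -/
theorem exists_eq_of_sum_pow_eq {a b : Fin 4 → ℝ}
    (h : ∀ k ∈ Finset.Icc 1 4, ∑ i, a i ^ k = ∑ i, b i ^ k) (i : Fin 4) : ∃ j, a i = b j := by
  have h1 := h 1 (by decide)
  have h2 := h 2 (by decide)
  have h3 := h 3 (by decide)
  have h4 := h 4 (by decide)
  simp only [Fin.sum_univ_four, pow_one] at h1 h2 h3 h4
  -- Newton's identities express the monic polynomial with given roots through their power sums.
  have newton : ∀ (c : Fin 4 → ℝ) (t : ℝ), 24 * ∏ k, (t - c k) =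
      let p := fun n ↦ c 0 ^ n + c 1 ^ n + c 2 ^ n + c 3 ^ n
      24 * t ^ 4 - 24 * (c 0 + c 1 + c 2 + c 3) * t ^ 3 +
        12 * ((c 0 + c 1 + c 2 + c 3) ^ 2 - p 2) * t ^ 2 -
        4 * ((c 0 + c 1 + c 2 + c 3) ^ 3 - 3 * (c 0 + c 1 + c 2 + c 3) * p 2 + 2 * p 3) * t +
        ((c 0 + c 1 + c 2 + c 3) ^ 4 - 6 * (c 0 + c 1 + c 2 + c 3) ^ 2 * p 2 + 3 * p 2 ^ 2 +
          8 * (c 0 + c 1 + c 2 + c 3) * p 3 - 6 * p 4) := by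
    intro c t
    simp only [Fin.prod_univ_four]
    ring
  have hprod : ∏ k, (a i - b k) = 0 := by
    have ha := newton a (a i)
    have hb := newton b (a i)
    simp only at ha hb
    rw [h1, h2, h3, h4, ← hb, Finset.prod_eq_zero (Finset.mem_univ i) (sub_self _)] at ha
    linarith
  obtain ⟨j, -, hj⟩ := Finset.prod_eq_zero_iff.1 hprod
  exact ⟨j, sub_eq_zero.1 hj⟩

theorem Matrix.IsHermitian.trace_pow_eq_sum {n : ℕ} {H : Matrix (Fin n) (Fin n) ℂ}
    (hH : H.IsHermitian) (k : ℕ) : (H ^ k).trace = ((∑ i, hH.eigenvalues i ^ k : ℝ) : ℂ) := by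
  conv_lhs => rw [hH.spectral_theorem, ← map_pow, diagonal_pow, Unitary.conjStarAlgAut_apply,
    trace_mul_cycle, Unitary.coe_star_mul_self, one_mul, trace_diagonal]
  simp

/-- The words of length three in `X` and `Y`, collected up to cyclic permutation. -/
theorem Matrix.trace_add_pow_three {n R : Type*} [Fintype n] [DecidableEq n] [CommRing R]
    (X Y : Matrix n n R) : ((X + Y) ^ 3).trace =
      (X ^ 3).trace + 3 * (X * X * Y).trace + 3 * (Y * Y * X).trace + (Y ^ 3).trace := by
  have h1 := trace_mul_cycle X Y X
  have h2 := trace_mul_cycle Y X X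
  have h3 := trace_mul_cycle X Y Y
  have h4 := trace_mul_cycle Y X Y
  simp only [pow_succ, pow_zero, one_mul, add_mul, mul_add, trace_add] at h1 h2 h3 h4 ⊢
  linear_combination 2 * h1 + h2 + h3 + 2 * h4

/-- The words of length four in `X` and `Y`, collected up to cyclic permutation. -/
theorem Matrix.trace_add_pow_four {n R : Type*} [Fintype n] [DecidableEq n] [CommRing R]
    (X Y : Matrix n n R) : ((X + Y) ^ 4).trace =
      (X ^ 4).trace + 4 * (X * X * X * Y).trace + 4 * ((X * Y) * (Y * X)).trace +
        2 * ((X * Y) * (X * Y)).trace + 4 * (Y * Y * Y * X).trace + (Y ^ 4).trace := by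
  have c := fun A B C D : Matrix n n R ↦ trace_mul_comm A (B * C * D)
  have h1 := c X X X Y
  have h2 := c X X Y X
  have h3 := c X Y X X
  have h4 := c Y Y Y X
  have h5 := c Y Y X Y
  have h6 := c Y X Y Y
  have h7 := c X X Y Y
  have h8 := c X Y Y X
  have h9 := c Y Y X X
  have h10 := c X Y X Y
  simp only [pow_succ, pow_zero, one_mul, add_mul, mul_add, trace_add, mul_assoc] at *
  linear_combination -3 * h1 - 2 * h2 - h3 - 3 * h4 - 2 * h5 - h6 + h7 - 2 * h8 - h9 - h10

/-- Cyclic invariance and `X X* X = X` reduce these traces to those of powers of `X`. -/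
theorem trace_mul_conjTranspose_eq_zero {n : ℕ} {X : Matrix (Fin n) (Fin n) ℂ}
    (hX : X * Xᴴ * X = X) (hnil : IsNilpotent X) :
    (X * X * Xᴴ).trace = 0 ∧ (X * X * X * Xᴴ).trace = 0 := by
  have h (k : ℕ) (hk : k ≠ 0) : (X ^ k).trace = 0 :=
    (isNilpotent_trace_of_isNilpotent (hnil.pow_of_pos hk)).eq_zero
  constructor
  · rw [Matrix.trace_mul_cycle, Matrix.trace_mul_cycle, hX]
    simpa using h 1 one_ne_zero
  · rw [Matrix.trace_mul_cycle, Matrix.trace_mul_cycle, ← mul_assoc (X * Xᴴ) X X, hX, ← sq]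
    exact h 2 two_ne_zero

/-- For a nilpotent partial isometry, every word in `c A` and `(c A)*` of length at most four whose
trace depends on the phase `c` has trace zero. -/
theorem trace_rePart_smul_pow {n : ℕ} {A : Matrix (Fin n) (Fin n) ℂ} (hA : A * Aᴴ * A = A)
    (hnil : IsNilpotent A) {c : ℂ} (hc : ‖c‖ = 1) {k : ℕ} (hk : k ∈ Finset.Icc 1 4) :
    ((rePart (c • A)) ^ k).trace = ((rePart A) ^ k).trace := by
  have hcc : c * star c = 1 := by rw [Complex.star_def, Complex.mul_conj', hc]; simp
  have hA' : Aᴴ * Aᴴᴴ * Aᴴ = Aᴴ := by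
    conv_rhs => rw [← hA]
    simp [mul_assoc]
  have hnil' : IsNilpotent Aᴴ := by
    obtain ⟨m, hm⟩ := hnil
    exact ⟨m, by rw [← conjTranspose_pow, hm, conjTranspose_zero]⟩
  have t (k : ℕ) (hk : k ≠ 0) : (A ^ k).trace = 0 :=
    (isNilpotent_trace_of_isNilpotent (hnil.pow_of_pos hk)).eq_zero
  have t' (k : ℕ) (hk : k ≠ 0) : (Aᴴ ^ k).trace = 0 :=
    (isNilpotent_trace_of_isNilpotent (hnil'.pow_of_pos hk)).eq_zero
  obtain ⟨h1, h2⟩ := trace_mul_conjTranspose_eq_zero hA hnil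
  obtain ⟨h3, h4⟩ := trace_mul_conjTranspose_eq_zero hA' hnil'
  rw [conjTranspose_conjTranspose] at h3 h4
  have ht := t 1 one_ne_zero
  have ht' := t' 1 one_ne_zero
  have ht2 := t 2 two_ne_zero
  have ht2' := t' 2 two_ne_zero
  rw [pow_one] at ht ht'
  rw [sq] at ht2 ht2'
  simp only [rePart, conjTranspose_smul, smul_pow, trace_smul]
  congr 1
  rw [Finset.mem_Icc] at hk
  obtain ⟨hk1, hk4⟩ := hk
  interval_cases k
  · simp only [pow_one, trace_add, trace_smul, ht, ht', smul_zero]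
  · simp only [sq, add_mul, mul_add, trace_add, smul_mul_smul_comm, trace_smul, ht2, ht2', hcc,
      mul_comm (star c) c, one_smul, smul_zero]
  · simp only [trace_add_pow_three, smul_pow, smul_mul_smul_comm, trace_smul, h1, h3,
      t 3 three_ne_zero, t' 3 three_ne_zero, smul_zero]
  · simp only [trace_add_pow_four, smul_pow, smul_mul_smul_comm, trace_smul, h2, h4,
      t 4 four_ne_zero, t' 4 four_ne_zero, smul_zero, hcc, mul_comm (star c) c, one_smul]

theorem exists_eigenvalues_eq_of_apply_eq {n : ℕ} {H : Matrix (Fin n) (Fin n) ℂ}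
    (hH : H.IsHermitian) {l : ℝ} {x : EuclideanSpace ℂ (Fin n)} (hx : x ≠ 0)
    (h : op H x = (l : ℂ) • x) : ∃ i, hH.eigenvalues i = l := by
  have h1 : End.HasEigenvalue (op H) (l : ℂ) :=
    End.hasEigenvalue_of_hasEigenvector ⟨End.mem_eigenspace_iff.2 h, hx⟩
  have h2 := h1.mem_spectrum
  rw [op, spectrum_toLpLin, hH.spectrum_eq_image_range] at h2
  obtain ⟨_, ⟨i, rfl⟩, hi⟩ := h2
  exact ⟨i, Complex.ofReal_injective hi⟩

/-- Rotating a nilpotent partial isometry does not change the eigenvalues of its real part. -/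
theorem exists_eigenvector_rePart_smul {A : Matrix (Fin 4) (Fin 4) ℂ} (hA : A * Aᴴ * A = A)
    (hnil : IsNilpotent A) {c d : ℂ} (hc : ‖c‖ = 1) (hd : ‖d‖ = 1) {l : ℝ}
    {x : EuclideanSpace ℂ (Fin 4)} (hx : x ≠ 0) (h : op (rePart (c • A)) x = (l : ℂ) • x) :
    ∃ y, ‖y‖ = 1 ∧ op (rePart (d • A)) y = (l : ℂ) • y := by
  obtain ⟨i, hi⟩ := exists_eigenvalues_eq_of_apply_eq (rePart_isHermitian (c • A)) hx h
  have hdH := rePart_isHermitian (d • A)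
  obtain ⟨j, hj⟩ := exists_eq_of_sum_pow_eq
    (a := (rePart_isHermitian (c • A)).eigenvalues) (b := hdH.eigenvalues) (fun k hk ↦ by
    have h := (trace_rePart_smul_pow hA hnil hc hk).trans (trace_rePart_smul_pow hA hnil hd hk).symm
    rw [(rePart_isHermitian (c • A)).trace_pow_eq_sum, hdH.trace_pow_eq_sum] at h
    exact Complex.ofReal_injective h) i
  refine ⟨hdH.eigenvectorBasis j, hdH.eigenvectorBasis.orthonormal.1 j, ?_⟩
  rw [← hi, hj]
  have := hdH.mulVec_eigenvectorBasis j
  ext k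
  simpa using congrFun this k

/-- The support function of the numerical range of a nilpotent partial isometry is constant. -/
theorem exists_support_numericalRange {A : Matrix (Fin 4) (Fin 4) ℂ} (hA : A * Aᴴ * A = A)
    (hnil : IsNilpotent A) : ∃ r : ℝ, ∀ c : ℂ, ‖c‖ = 1 →
      (∀ w ∈ numericalRange A, (c * w).re ≤ r) ∧ ∃ w ∈ numericalRange A, (c * w).re = r := by
  have hne : (numericalRange A).Nonempty := by
    obtain ⟨x, hx⟩ := exists_norm_eq (EuclideanSpace ℂ (Fin 4)) zero_le_one
    exact ⟨_, x, hx, rfl⟩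
  have hmax (c : ℂ) : ∃ w ∈ numericalRange A, ∀ z ∈ numericalRange A, (c * z).re ≤ (c * w).re :=
    (isCompact_setOf_inner_apply (op A)).exists_isMaxOn hne (f := fun z ↦ (c * z).re)
      (by fun_prop)
  have hq (c : ℂ) (z) : inner ℂ z (op (c • A) z) = c * inner ℂ z (op A z) := by
    rw [op_smul, LinearMap.smul_apply, inner_smul_right]
  -- The maximum of `Re (c w)` over `W(A)` is an eigenvalue of `Re (c A)`, and by invariance of the
  -- eigenvalues it is attained in every other direction `d`.
  have key (c d : ℂ) (hc : ‖c‖ = 1) (hd : ‖d‖ = 1) (w : ℂ) (hw : w ∈ numericalRange A)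
      (h : ∀ z ∈ numericalRange A, (c * z).re ≤ (c * w).re) :
      ∃ v ∈ numericalRange A, (d * v).re = (c * w).re := by
    obtain ⟨x, hx, rfl⟩ := hw
    have h1 := apply_add_adjoint_apply_of_re_inner_le (T := op (c • A)) hx (fun y hy ↦ by
      rw [hq, hq]
      exact h _ ⟨y, hy, rfl⟩)
    rw [← op_rePart, mul_smul] at h1
    obtain ⟨y, hy, hyl⟩ := exists_eigenvector_rePart_smul hA hnil hc hd
      (by rintro rfl; simp at hx) (smul_right_injective _ two_ne_zero h1)
    refine ⟨_, ⟨y, hy, rfl⟩, ?_⟩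
    have h2 := congrArg (fun v ↦ (inner ℂ y v).re) (op_rePart (d • A) y)
    simp only [hyl, inner_add_right, adjoint_inner_right, inner_smul_right,
      inner_self_eq_norm_sq_to_K, hy, Complex.add_re] at h2
    rw [← inner_conj_symm (op (d • A) y) y, Complex.conj_re, hq, hq] at h2
    simp only [map_one, one_pow, mul_one, Complex.re_ofNat, Complex.im_ofNat,
      Complex.mul_re, Complex.ofReal_re, zero_mul, sub_zero] at h2 ⊢
    linarith
  obtain ⟨w, hw, hwm⟩ := hmax 1
  refine ⟨(1 * w).re, fun c hc ↦ ?_⟩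
  obtain ⟨v, hv, hvm⟩ := hmax c
  obtain ⟨v', hv', h1⟩ := key c 1 hc (by simp) v hv hvm
  refine ⟨fun z hz ↦ (hvm z hz).trans (h1 ▸ hwm v' hv'), key 1 c (by simp) hc w hw hwm⟩

/-- The radius is the constant value `r` of the support function; `r = 0` makes the quadratic form of
`A` vanish, which over the complex numbers forces `A = 0`. -/
theorem numericalRange_eq_closedBall {A : Matrix (Fin 4) (Fin 4) ℂ} (hA : A * Aᴴ * A = A)
    (hnil : IsNilpotent A) : ∃ r : ℝ, 0 ≤ r ∧ (A ≠ 0 → 0 < r) ∧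
      numericalRange A = Metric.closedBall (0 : ℂ) r := by
  obtain ⟨r, hr⟩ := exists_support_numericalRange hA hnil
  have hsub : ∀ z ∈ numericalRange A, ‖z‖ ≤ r := by
    intro z hz
    obtain ⟨c, hc, hcz⟩ := RCLike.exists_norm_eq_mul_self z
    have := (hr c hc).1 z hz
    rw [← hcz] at this
    simpa using this
  obtain ⟨w₀, hw₀, -⟩ := (hr 1 (by simp)).2
  have hr0 : 0 ≤ r := (norm_nonneg _).trans (hsub w₀ hw₀)
  have heq : numericalRange A = Metric.closedBall (0 : ℂ) r := by
    refine Set.Subset.antisymm (fun z hz ↦ mem_closedBall_zero_iff.2 (hsub z hz)) fun z hz ↦ ?_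
    rw [mem_closedBall_zero_iff] at hz
    by_contra hzW
    obtain ⟨f, u, hfu, huz⟩ := RCLike.geometric_hahn_banach_closed_point (𝕜 := ℂ)
      (convex_setOf_inner_apply (op A)) (isCompact_setOf_inner_apply (op A)).isClosed hzW
    have hf : ∀ w, f w = f 1 * w := by
      intro w
      rw [mul_comm, ← smul_eq_mul, ← map_smul, smul_eq_mul, mul_one]
    have hlt : ∀ w ∈ numericalRange A, (f 1 * w).re < (f 1 * z).re := by
      intro w hw
      rw [← hf, ← hf]
      exact (hfu w hw).trans huz
    have hf1 : f 1 ≠ 0 := by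
      intro h
      simpa [h] using hlt w₀ hw₀
    obtain ⟨w, hw, hwr⟩ := (hr ((‖f 1‖⁻¹ : ℝ) * f 1) (by simp [hf1])).2
    rw [mul_assoc, Complex.re_ofReal_mul, inv_mul_eq_iff_eq_mul₀ (norm_ne_zero_iff.2 hf1)] at hwr
    have h1 := hlt w hw
    have h2 := Complex.re_le_norm (f 1 * z)
    rw [norm_mul] at h2
    have h3 := mul_le_mul_of_nonneg_left hz (norm_nonneg (f 1))
    linarith
  refine ⟨r, hr0, fun hA0 ↦ lt_of_le_of_ne hr0 fun h ↦ hA0 ?_, heq⟩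
  have h0 : op A = 0 := by
    refine (inner_map_self_eq_zero _).1 fun x ↦ ?_
    by_cases hx : x = 0
    · simp [hx]
    have h1 := hsub _ ⟨((‖x‖⁻¹ : ℝ) : ℂ) • x, by simp [norm_smul, hx], rfl⟩
    rw [← h, norm_le_zero_iff, map_smul, inner_smul_left, inner_smul_right] at h1
    exact inner_eq_zero_symm.1 (by simpa [hx] using h1)
  exact Matrix.toEuclideanLin.injective (h0.trans (map_zero _).symm)

theorem NumRange.IsPartialIsometry.mul_conjTranspose_mul {n : ℕ} {A : Matrix (Fin n) (Fin n) ℂ}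
    (hA : IsPartialIsometry A) : A * Aᴴ * A = A := by
  refine Matrix.toEuclideanLin.injective (LinearMap.ext fun x ↦ ?_)
  have h := apply_adjoint_apply_of_isometry_on_ker_orthogonal hA x
  rw [← Matrix.toEuclideanLin_conjTranspose_eq_adjoint] at h
  rw [← h]
  simp [op, Matrix.toLpLin_apply, Matrix.mulVec_mulVec, mul_assoc]

end Nilpotent

theorem mainTheorem3 (A : Matrix (Fin 4) (Fin 4) ℂ) (hA : NumRange.IsPartialIsometry A) :
    (NumRange.IsUnitarilyIrreducible A →
      NumRange.IsGeneric A ∧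
        ∀ a b : ℂ, segment ℝ a b ⊆ frontier (NumRange.numericalRange A) → a = b) ∧
    (IsNilpotent A →
      ∃ r : ℝ, 0 ≤ r ∧ (A ≠ 0 → 0 < r) ∧
        NumRange.numericalRange A = Metric.closedBall (0 : ℂ) r) :=
  ⟨fun hirr ↦ ⟨isGeneric_of_isPartialIsometry hA hirr.isIrreducible,
    fun _ _ ↦ eq_of_segment_subset_frontier hA hirr.isIrreducible⟩,
    numericalRange_eq_closedBall hA.mul_conjTranspose_mul⟩
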